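/- Let $m\ge 0$ elementary hypotheses $H_1,\dots,H_m$ be tested in each of two studies; let $h_{ij}\in\{0,1\}$ indicate whether $H_j$ is false in study $i$, and let $P_{ij}$ be the $p$-value of $H_j$ in study $i$, where $\Pr(P_{ij}\le x)\le x$ for all $x\in[0,1]$ whenever $h_{ij}=0$. The no replicability null hypothesis $H_{NR,j}$ is true unless $h_{1j}=h_{2j}=1$. The FDR of a procedure that rejects $R$ of the hypotheses $H_{NR,1},\dots,H_{NR,m}$, of which $V$ are true, is $E[V/\max(R,1)]$. *Two stage procedure with parameters $(q_1,q)$.* Let $p_1,p_2\in\mathbb R^m$ be the vectors of $p$-values of the primary and of the follow-up study, let $\mathcal R_1=\mathcal R_1(p_1)\subseteq\{1,\dots,m\}$ be the set of indices selected on the basis of the primary study, and let $R_1=|\mathcal R_1|$. Put $$R_2=\max\Big\{r:\ \#\big\{j\in\mathcal R_1:\ p_{1j}\le \tfrac{r q_1}{m},\ p_{2j}\le \tfrac{r(q-q_1)}{R_1}\big\}=r\Big\}$$ and reject $H_{NR,j}$ for those $j\in\mathcal R_1$ with $p_{1j}\le R_2q_1/m$ and $p_{2j}\le R_2(q-q_1)/R_1$.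 In the *harmonic modification*, $q_1$ is replaced by $q_1/\sum_{i=1}^m\frac1i$ in $rq_1/m$ and $R_2q_1/m$, and $q-q_1$ is replaced by $(q-q_1)/\sum_{i=1}^{R_1}\frac1i$ in $r(q-q_1)/R_1$ and $R_2(q-q_1)/R_1$. *Generalized procedure with parameters $(w_1,q_1,q)$, $0\le w_1\le1$, $0<q_1<q<1$.* Reject the union of the hypotheses rejected by the two stage procedure with parameters $(w_1q_1,w_1q)$ with study one as the primary study, and of those rejected by it with parameters $((1-w_1)q_1,(1-w_1)q)$ with study two as the primary study. A set of $p$-values $P_1,\dots,P_m$ has property PRDS if for every increasing set $D\subseteq\mathbb R^m$ and every true null hypothesis $i$, $\Pr((P_1,\dots,P_m)\in D\mid P_i=p)$ is nondecreasing in $p$ (has a nondecreasing version). **Theorem.** Assume that the vectors of $p$-values $(P_{11},\dots,P_{1m})$ and $(P_{21},\dots,P_{2m})$ of the two studies are independent. Then the generalized procedure with parameters $(w_1,q_1,q)$ controls the FDR at level $q$, i.e. its FDR is at most $q$, for the family $H_{NR,1},\dots,H_{NR,m}$ in each of the following situations: 1. The set of $p$-values within each study has property PRDS, and selection is by Bonferroni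 at level $w_1q_1$ when study one is the primary study (select $j$ if $P_{1j}\le w_1q_1/m$) and at level $(1-w_1)q_1$ when study two is the primary study (select $j$ if $P_{2j}\le(1-w_1)q_1/m$). 2. The dependence among the $p$-values within each study is arbitrary, the selection rules (one for each choice of the primary study) are arbitrary measurable functions of the primary-study $p$-values, and the harmonic modification of the two stage procedure is used in both steps. -/

import Mathlib

open MeasureTheory ProbabilityTheory

/-- A selection rule maps the vector of primary-study `p`-values to the set of selected indices. -/
abbrev SelectionRule (m : ℕ) : Type := (Fin m → ℝ) → Finset (Fin m)

/-- A selection rule is measurable if each event "index `j` is selected" is Borel. -/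
def SelectionRule.IsMeasurable {m : ℕ} (sel : SelectionRule m) : Prop :=
  ∀ j : Fin m, MeasurableSet {p : Fin m → ℝ | j ∈ sel p}

/-- Bonferroni selection at level `α`: select `j` when its `p`-value is at most `α / m`. -/
noncomputable def bonferroniSelection (m : ℕ) (α : ℝ) : SelectionRule m :=
  fun p => Finset.univ.filter fun j => p j ≤ α / m

/-- The indices `j` of the selected set `S` whose pair of `p`-values is componentwise at most
`(r * a / m, r * b / |S|)`. -/
noncomputable def jointlySmall {m : ℕ} (a b : ℝ) (S : Finset (Fin m)) (p₁ p₂ : Fin m → ℝ)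
    (r : ℕ) : Finset (Fin m) :=
  S.filter fun j => p₁ j ≤ r * a / m ∧ p₂ j ≤ r * b / S.card

/-- The number `R₂` of the two stage procedure: the largest `r` such that exactly `r` selected
indices have `p`-values at most `(r * a / m, r * b / |S|)`. Such an `r` is at most `|S|`. -/
noncomputable def twoStageCount {m : ℕ} (a b : ℝ) (S : Finset (Fin m)) (p₁ p₂ : Fin m → ℝ) : ℕ :=
  Nat.findGreatest (fun r => (jointlySmall a b S p₁ p₂ r).card = r) S.card

/-- `twoStageCount` is indeed the maximum of the set of fixed points (which is never empty). -/
theorem isGreatest_twoStageCount {m : ℕ} {a b : ℝ} (ha : 0 ≤ a) (hb : 0 ≤ b)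
    (S : Finset (Fin m)) (p₁ p₂ : Fin m → ℝ) :
    IsGreatest {r : ℕ | (jointlySmall a b S p₁ p₂ r).card = r} (twoStageCount a b S p₁ p₂) := by
  have hle : ∀ r, (jointlySmall a b S p₁ p₂ r).card ≤ S.card := fun r =>
    Finset.card_le_card (Finset.filter_subset _ _)
  have hmono : ∀ r s : ℕ, r ≤ s →
      (jointlySmall a b S p₁ p₂ r).card ≤ (jointlySmall a b S p₁ p₂ s).card := by
    intro r s hrs
    refine Finset.card_le_card fun j hj => ?_
    have hrs' : (r : ℝ) ≤ s := by exact_mod_cast hrs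
    simp only [jointlySmall, Finset.mem_filter] at hj ⊢
    exact ⟨hj.1, hj.2.1.trans (by gcongr), hj.2.2.trans (by gcongr)⟩
  obtain ⟨k, hk, hkS⟩ : ∃ k, (jointlySmall a b S p₁ p₂ k).card = k ∧ k ≤ S.card := by
    set k := Nat.findGreatest (fun r => r ≤ (jointlySmall a b S p₁ p₂ r).card) S.card with hkdef
    have h1 : k ≤ (jointlySmall a b S p₁ p₂ k).card :=
      Nat.findGreatest_spec (P := fun r => r ≤ (jointlySmall a b S p₁ p₂ r).card)
        (Nat.zero_le S.card) (Nat.zero_le _)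
    have h2 : (jointlySmall a b S p₁ p₂ k).card ≤ k :=
      Nat.le_findGreatest (P := fun r => r ≤ (jointlySmall a b S p₁ p₂ r).card)
        (hle k) (hmono _ _ h1)
    exact ⟨k, le_antisymm h2 h1, Nat.findGreatest_le _⟩
  refine ⟨?_, fun r hr => ?_⟩
  · exact Nat.findGreatest_spec (P := fun r => (jointlySmall a b S p₁ p₂ r).card = r) hkS hk
  · have hr' : (jointlySmall a b S p₁ p₂ r).card = r := hr
    exact Nat.le_findGreatest (P := fun r => (jointlySmall a b S p₁ p₂ r).card = r)
      (hr' ▸ hle r) hr'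

/-- The indices rejected by the two stage procedure with level `a` in the thresholds of the
primary study and level `b` in those of the follow-up study, when `S` is the selected set. -/
noncomputable def twoStageRejections {m : ℕ} (a b : ℝ) (S : Finset (Fin m))
    (p₁ p₂ : Fin m → ℝ) : Finset (Fin m) :=
  jointlySmall a b S p₁ p₂ (twoStageCount a b S p₁ p₂)

/-- The two stage procedure with parameters `(q₁, q)`; `p₁` holds the `p`-values of the primary
study and `p₂` those of the follow-up study. -/
noncomputable def twoStageFDR {m : ℕ} (q₁ q : ℝ) (sel : SelectionRule m) (p₁ p₂ : Fin m → ℝ) :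
    Finset (Fin m) :=
  twoStageRejections q₁ (q - q₁) (sel p₁) p₁ p₂

/-- The modification of the two stage procedure in which `q₁` is divided by the harmonic sum
`∑_{i=1}^m 1/i` and `q - q₁` by the harmonic sum `∑_{i=1}^{R₁} 1/i`, `R₁` being the number of
selected indices. -/
noncomputable def twoStageFDRHarmonic {m : ℕ} (q₁ q : ℝ) (sel : SelectionRule m)
    (p₁ p₂ : Fin m → ℝ) : Finset (Fin m) :=
  twoStageRejections (q₁ / (harmonic m : ℝ)) ((q - q₁) / (harmonic (sel p₁).card : ℝ)) (sel p₁)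
    p₁ p₂

/-- The generalized two stage procedure with parameters `(w₁, q₁, q)` built on a two stage
procedure `proc`: the union of the rejections of `proc` at `(w₁ q₁, w₁ q)` with study one as the
primary study (and selection rule `sel₁`), and at `((1 - w₁) q₁, (1 - w₁) q)` with study two as
the primary study (and selection rule `sel₂`). -/
noncomputable def generalizedTwoStage {m : ℕ}
    (proc : ℝ → ℝ → SelectionRule m → (Fin m → ℝ) → (Fin m → ℝ) → Finset (Fin m))
    (w₁ q₁ q : ℝ) (sel₁ sel₂ : SelectionRule m) (p₁ p₂ : Fin m → ℝ) : Finset (Fin m) :=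
  proc (w₁ * q₁) (w₁ * q) sel₁ p₁ p₂ ∪ proc ((1 - w₁) * q₁) ((1 - w₁) * q) sel₂ p₂ p₁

/-- The no replicability null hypothesis for index `j`. Here `h i j` indicates whether the
elementary hypothesis `j` is false in study `i`; the no replicability null hypothesis is true
unless the elementary hypothesis is false in both studies. -/
def NoReplicability {m : ℕ} (h : Fin 2 → Fin m → Bool) (j : Fin m) : Prop :=
  ¬(h 0 j = true ∧ h 1 j = true)

open Classical in
/-- The false discovery proportion `V / max(R, 1)` of a set `R` of rejected no replicability null
hypotheses. -/
noncomputable def falseDiscoveryProportion {m : ℕ} (h : Fin 2 → Fin m → Bool)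
    (R : Finset (Fin m)) : ℝ :=
  ((R.filter fun j => NoReplicability h j).card : ℝ) / max (R.card : ℝ) 1

/-- The false discovery rate, for the family of no replicability null hypotheses, of the procedure
`proc` applied to the `p`-values `P i j` of study `i` and hypothesis `j` is (well defined and) at
most `q`. -/
def ControlsFDR {Ω : Type*} [MeasurableSpace Ω] (μ : Measure Ω) {m : ℕ}
    (h : Fin 2 → Fin m → Bool) (P : Fin 2 → Fin m → Ω → ℝ)
    (proc : (Fin m → ℝ) → (Fin m → ℝ) → Finset (Fin m)) (q : ℝ) : Prop :=
  Integrable (fun ω => falseDiscoveryProportion h (proc (fun j => P 0 j ω) fun j => P 1 j ω)) μ ∧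
    ∫ ω, falseDiscoveryProportion h (proc (fun j => P 0 j ω) fun j => P 1 j ω) ∂μ ≤ q

/-- Positive regression dependency on the subset of true null hypotheses: for each increasing
(Borel) set `D` and each true null hypothesis `i`, the conditional probability of `X ∈ D` given
`X i = x` is nondecreasing in `x`. Conditional probabilities are determined only up to null sets,
so this says that they have a nondecreasing version. -/
def IsPRDS {Ω : Type*} [MeasurableSpace Ω] (μ : Measure Ω) {m : ℕ} (X : Fin m → Ω → ℝ)
    (trueNull : Fin m → Prop) : Prop :=
  ∀ D : Set (Fin m → ℝ), MeasurableSet D → IsUpperSet D → ∀ i : Fin m, trueNull i →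
    ∃ g : ℝ → ℝ, Monotone g ∧
      μ⟦(fun ω j => X j ω) ⁻¹' D | MeasurableSpace.comap (X i) inferInstance⟧
        =ᵐ[μ] fun ω => g (X i ω)

/-! ### Set-valued statistics -/

/-! The false discovery proportion is a sum over true nulls `j` of the weight `1/|T|` if `j ∈ T`,
else `0`. Enlarging a set containing `j` lowers `1/|T|`, so the proportion is subadditive under
unions. It is therefore enough to bound the FDR of the two runs by `w₁ * q` and `(1 - w₁) * q`
(`controlsFDR_union`).

Consider one run with levels `a` for the primary study and `b = q - a` for the follow-up. A true no
replicability null is null in at least one study, so the expectation splits into two parts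
(`integral_falseDiscoveryProportion_le`). A primary null should cost at most `a/m`. For follow-up
nulls, independence allows fixing the primary p-values, hence the selected set `S`; each selected
null should then cost at most `b/|S|`.

Under Bonferroni selection the primary bound is just `Pr(P ≤ a/m) ≤ a/m`. All other bounds concern
`E[1{P ≤ cR}/R]`, with `R` the number of rejections. Under PRDS it is at most `c`, since `R`
decreases in the follow-up p-values (`IsPRDS.integral_stepUpWeight_le`). Under arbitrary dependence,
summation by parts gives `c` times the harmonic number of a bound for `R`
(`integral_stepUpWeight_le_harmonic`), which the modified levels cancel. -/

theorem measurableSet_setOf_finset {α ι : Type*} [MeasurableSpace α] [Fintype ι]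
    {f : α → Finset ι} (hf : ∀ j, MeasurableSet {x | j ∈ f x}) (Q : Finset ι → Prop) :
    MeasurableSet {x | Q (f x)} := by
  have h : {x | Q (f x)} =
      ⋃ T ∈ {T : Finset ι | Q T}, ⋂ j, {x | j ∈ f x ↔ j ∈ T} := by
    ext x
    simp only [Set.mem_ofPred_eq, Set.mem_iUnion, Set.mem_iInter, exists_prop]
    refine ⟨fun hx => ⟨f x, hx, fun j => Iff.rfl⟩, ?_⟩
    rintro ⟨T, hT, hx⟩
    rwa [Finset.ext hx]
  rw [h]
  refine MeasurableSet.biUnion (Set.to_countable _) fun T _ => MeasurableSet.iInter fun j => ?_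
  by_cases hj : j ∈ T
  · simp only [hj, iff_true]
    exact hf j
  · simp only [hj, iff_false]
    exact (hf j).compl

theorem measurable_comp_finset {α ι β : Type*} [MeasurableSpace α] [MeasurableSpace β] [Fintype ι]
    {f : α → Finset ι} (hf : ∀ j, MeasurableSet {x | j ∈ f x}) (F : Finset ι → β) :
    Measurable fun x => F (f x) :=
  fun s _ => measurableSet_setOf_finset hf fun T => F T ∈ s

theorem integrable_comp_finset {α ι : Type*} [MeasurableSpace α] [Fintype ι]
    {μ : Measure α} [IsFiniteMeasure μ]
    {f : α → Finset ι} (hf : ∀ j, MeasurableSet {x | j ∈ f x}) (F : Finset ι → ℝ) :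
    Integrable (fun x => F (f x)) μ :=
  Integrable.of_bound (measurable_comp_finset hf F).aestronglyMeasurable (∑ T, ‖F T‖)
    (ae_of_all _ fun x => Finset.single_le_sum (f := fun T => ‖F T‖)
      (fun _ _ => norm_nonneg _) (Finset.mem_univ (f x)))

/-! ### Decomposition of the false discovery proportion over indices. -/

/-- The contribution of index `j` to the false discovery proportion of the rejected set `T`. -/
noncomputable def rejectionWeight {ι : Type*} [DecidableEq ι] (j : ι) (T : Finset ι) : ℝ :=
  if j ∈ T then (T.card : ℝ)⁻¹ else 0

theorem rejectionWeight_nonneg {ι : Type*} [DecidableEq ι] (j : ι) (T : Finset ι) :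
    0 ≤ rejectionWeight j T := by
  unfold rejectionWeight
  split_ifs <;> positivity

theorem rejectionWeight_le_one {ι : Type*} [DecidableEq ι] (j : ι) (T : Finset ι) :
    rejectionWeight j T ≤ 1 := by
  unfold rejectionWeight
  split_ifs
  · exact Nat.cast_inv_le_one _
  · exact zero_le_one

theorem rejectionWeight_union_le {ι : Type*} [DecidableEq ι] (j : ι) (T U : Finset ι) :
    rejectionWeight j (T ∪ U) ≤ rejectionWeight j T + rejectionWeight j U := by
  by_cases hT : j ∈ T
  · refine le_add_of_le_of_nonneg ?_ (rejectionWeight_nonneg j U)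
    have : (0 : ℝ) < T.card := by exact_mod_cast Finset.card_pos.2 ⟨j, hT⟩
    simp only [rejectionWeight, Finset.mem_union, hT, true_or, if_true]
    gcongr
    exact Finset.subset_union_left
  by_cases hU : j ∈ U
  · refine le_add_of_nonneg_of_le (rejectionWeight_nonneg j T) ?_
    have : (0 : ℝ) < U.card := by exact_mod_cast Finset.card_pos.2 ⟨j, hU⟩
    simp only [rejectionWeight, Finset.mem_union, hU, or_true, if_true]
    gcongr
    exact Finset.subset_union_right
  · simp [rejectionWeight, hT, hU]

open Classical in
theorem falseDiscoveryProportion_eq_sum {m : ℕ} (h : Fin 2 → Fin m → Bool) (T : Finset (Fin m)) :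
    falseDiscoveryProportion h T = ∑ j with NoReplicability h j, rejectionWeight j T := by
  rcases T.eq_empty_or_nonempty with rfl | hT
  · simp [falseDiscoveryProportion, rejectionWeight]
  have h1 : (1 : ℝ) ≤ T.card := by exact_mod_cast hT.card_pos
  simp only [falseDiscoveryProportion, rejectionWeight, max_eq_left h1]
  rw [← Finset.sum_filter, Finset.sum_const, nsmul_eq_mul, div_eq_mul_inv]
  congr 3
  ext j
  simp [and_comm]

theorem falseDiscoveryProportion_union_le {m : ℕ} (h : Fin 2 → Fin m → Bool)
    (T U : Finset (Fin m)) :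
    falseDiscoveryProportion h (T ∪ U) ≤
      falseDiscoveryProportion h T + falseDiscoveryProportion h U := by
  simp only [falseDiscoveryProportion_eq_sum, ← Finset.sum_add_distrib]
  exact Finset.sum_le_sum fun j _ => rejectionWeight_union_le j T U

/-- Union bound: an index that is null in both studies is counted twice. -/
theorem falseDiscoveryProportion_le_sum {m : ℕ} (h : Fin 2 → Fin m → Bool) {i i' : Fin 2}
    (hi : i ≠ i') (T : Finset (Fin m)) :
    falseDiscoveryProportion h T ≤
      ∑ j with h i j = false, rejectionWeight j T +
        ∑ j with h i' j = false, rejectionWeight j T := by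
  classical
  rw [falseDiscoveryProportion_eq_sum, ← Finset.sum_union_inter]
  refine le_add_of_le_of_nonneg (Finset.sum_le_sum_of_subset_of_nonneg ?_
    fun j _ _ => rejectionWeight_nonneg j T) (Finset.sum_nonneg fun j _ => rejectionWeight_nonneg j T)
  intro j
  simp only [NoReplicability, Finset.mem_filter, Finset.mem_univ, true_and, Finset.mem_union]
  fin_cases i <;> fin_cases i' <;> simp at hi ⊢ <;> cases h 0 j <;> cases h 1 j <;> simp

/-! ### The two stage procedure -/

section TwoStage

variable {m : ℕ} {a b : ℝ} {S : Finset (Fin m)} {p₁ p₂ : Fin m → ℝ}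

theorem card_jointlySmall_le (r : ℕ) : (jointlySmall a b S p₁ p₂ r).card ≤ S.card :=
  Finset.card_le_card (Finset.filter_subset _ _)

theorem jointlySmall_mono (ha : 0 ≤ a) (hb : 0 ≤ b) {r s : ℕ} (hrs : r ≤ s) :
    jointlySmall a b S p₁ p₂ r ⊆ jointlySmall a b S p₁ p₂ s := by
  intro j hj
  have hrs' : (r : ℝ) ≤ s := by exact_mod_cast hrs
  simp only [jointlySmall, Finset.mem_filter] at hj ⊢
  exact ⟨hj.1, hj.2.1.trans (by gcongr), hj.2.2.trans (by gcongr)⟩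

theorem card_twoStageRejections (ha : 0 ≤ a) (hb : 0 ≤ b) :
    (twoStageRejections a b S p₁ p₂).card = twoStageCount a b S p₁ p₂ :=
  (isGreatest_twoStageCount ha hb S p₁ p₂).1

theorem twoStageCount_le : twoStageCount a b S p₁ p₂ ≤ S.card :=
  Nat.findGreatest_le _

/-- The count is monotone in `r`, so the largest `k` not exceeding its own count is a fixed point;
hence an inequality suffices in place of the defining equality. -/
theorem le_twoStageCount (ha : 0 ≤ a) (hb : 0 ≤ b) {r : ℕ}
    (hr : r ≤ (jointlySmall a b S p₁ p₂ r).card) : r ≤ twoStageCount a b S p₁ p₂ := by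
  set k := Nat.findGreatest (fun r => r ≤ (jointlySmall a b S p₁ p₂ r).card) S.card with hkdef
  have h1 : k ≤ (jointlySmall a b S p₁ p₂ k).card :=
    Nat.findGreatest_spec (P := fun r => r ≤ (jointlySmall a b S p₁ p₂ r).card)
      (Nat.zero_le S.card) (Nat.zero_le _)
  have h2 : (jointlySmall a b S p₁ p₂ k).card ≤ k :=
    Nat.le_findGreatest (P := fun r => r ≤ (jointlySmall a b S p₁ p₂ r).card)
      (card_jointlySmall_le k) (Finset.card_le_card (jointlySmall_mono ha hb h1))
  have h3 : r ≤ k := Nat.le_findGreatest (P := fun r => r ≤ (jointlySmall a b S p₁ p₂ r).card)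
    (hr.trans (card_jointlySmall_le r)) hr
  exact h3.trans ((isGreatest_twoStageCount ha hb S p₁ p₂).2 (le_antisymm h2 h1))

/-- This makes `R₂ ≤ k` an increasing event in the follow-up p-values, to which PRDS applies. -/
theorem antitone_twoStageCount (ha : 0 ≤ a) (hb : 0 ≤ b) :
    Antitone fun p₂ => twoStageCount a b S p₁ p₂ := by
  intro x y hxy
  change twoStageCount a b S p₁ y ≤ twoStageCount a b S p₁ x
  refine le_twoStageCount ha hb ?_
  conv_lhs => rw [← card_twoStageRejections ha hb]
  refine Finset.card_le_card fun j hj => ?_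
  simp only [twoStageRejections, jointlySmall, Finset.mem_filter] at hj ⊢
  exact ⟨hj.1, hj.2.1, (hxy j).trans hj.2.2⟩

theorem measurableSet_mem_jointlySmall (a b : ℝ) (S : Finset (Fin m)) (r : ℕ) (j : Fin m) :
    MeasurableSet {p : (Fin m → ℝ) × (Fin m → ℝ) | j ∈ jointlySmall a b S p.1 p.2 r} := by
  simp only [jointlySmall, Finset.mem_filter]
  exact (MeasurableSet.const _).inter
    ((measurableSet_le ((measurable_pi_apply j).comp measurable_fst) measurable_const).inter
      (measurableSet_le ((measurable_pi_apply j).comp measurable_snd) measurable_const))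

theorem measurable_twoStageCount (a b : ℝ) (S : Finset (Fin m)) :
    Measurable fun p : (Fin m → ℝ) × (Fin m → ℝ) => twoStageCount a b S p.1 p.2 :=
  measurable_findGreatest fun r _ =>
    measurableSet_setOf_finset (measurableSet_mem_jointlySmall a b S r) fun T => T.card = r

theorem measurableSet_mem_twoStageRejections (a b : ℝ) (S : Finset (Fin m)) (j : Fin m) :
    MeasurableSet {p : (Fin m → ℝ) × (Fin m → ℝ) | j ∈ twoStageRejections a b S p.1 p.2} := by
  have h : {p : (Fin m → ℝ) × (Fin m → ℝ) | j ∈ twoStageRejections a b S p.1 p.2} =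
      ⋃ r : ℕ, {p | twoStageCount a b S p.1 p.2 = r} ∩
        {p | j ∈ jointlySmall a b S p.1 p.2 r} := by
    ext p
    simp [twoStageRejections]
  rw [h]
  exact MeasurableSet.iUnion fun r =>
    (measurable_twoStageCount a b S (measurableSet_singleton r)).inter
      (measurableSet_mem_jointlySmall a b S r j)

/-- The levels may depend on the selected set, as the harmonic modification requires; there are only
finitely many such sets to split over. -/
theorem measurableSet_mem_twoStageRejections_sel (a b : Finset (Fin m) → ℝ)
    {sel : SelectionRule m} (hsel : sel.IsMeasurable) (j : Fin m) :
    MeasurableSet {p : (Fin m → ℝ) × (Fin m → ℝ) |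
      j ∈ twoStageRejections (a (sel p.1)) (b (sel p.1)) (sel p.1) p.1 p.2} := by
  have h : {p : (Fin m → ℝ) × (Fin m → ℝ) |
        j ∈ twoStageRejections (a (sel p.1)) (b (sel p.1)) (sel p.1) p.1 p.2} =
      ⋃ S : Finset (Fin m), {p | sel p.1 = S} ∩
        {p | j ∈ twoStageRejections (a S) (b S) S p.1 p.2} := by
    ext p
    simp
  rw [h]
  refine MeasurableSet.iUnion fun S => MeasurableSet.inter ?_
    (measurableSet_mem_twoStageRejections (a S) (b S) S j)
  exact measurable_fst (measurableSet_setOf_finset hsel fun T => T = S)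

/-- The weight `1 / r` of a `p`-value `t` that is at most `c * r`. -/
noncomputable def stepUpWeight (c t : ℝ) (r : ℕ) : ℝ := if t ≤ c * r then (r : ℝ)⁻¹ else 0

theorem stepUpWeight_nonneg (c t : ℝ) (r : ℕ) : 0 ≤ stepUpWeight c t r := by
  unfold stepUpWeight
  split_ifs <;> positivity

theorem rejectionWeight_le_stepUpWeight_primary (ha : 0 ≤ a) (hb : 0 ≤ b) (j : Fin m) :
    rejectionWeight j (twoStageRejections a b S p₁ p₂) ≤
      stepUpWeight (a / m) (p₁ j) (twoStageCount a b S p₁ p₂) := by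
  rw [rejectionWeight, card_twoStageRejections ha hb]
  split_ifs with hj
  · simp only [twoStageRejections, jointlySmall, Finset.mem_filter] at hj
    rw [stepUpWeight, if_pos (hj.2.1.trans_eq (by ring))]
  · exact stepUpWeight_nonneg _ _ _

theorem rejectionWeight_le_stepUpWeight_followUp (ha : 0 ≤ a) (hb : 0 ≤ b) (j : Fin m) :
    rejectionWeight j (twoStageRejections a b S p₁ p₂) ≤
      stepUpWeight (b / S.card) (p₂ j) (twoStageCount a b S p₁ p₂) := by
  rw [rejectionWeight, card_twoStageRejections ha hb]
  split_ifs with hj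
  · simp only [twoStageRejections, jointlySmall, Finset.mem_filter] at hj
    rw [stepUpWeight, if_pos (hj.2.2.trans_eq (by ring))]
  · exact stepUpWeight_nonneg _ _ _

theorem rejectionWeight_eq_zero {j : Fin m} (hj : j ∉ S) :
    rejectionWeight j (twoStageRejections a b S p₁ p₂) = 0 :=
  if_neg fun h => hj (Finset.mem_filter.1 h).1

end TwoStage

/-! ### Expected weights -/

theorem natCast_mul_div_le {b : ℝ} (hb : 0 ≤ b) (n : ℕ) : n * (b / n) ≤ b := by
  rcases eq_or_ne (n : ℝ) 0 with h0 | h0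
  · rwa [h0, zero_mul]
  · rw [mul_div_cancel₀ _ h0]

section Expectation

variable {Ω : Type*} [MeasurableSpace Ω] {μ : Measure Ω} [IsProbabilityMeasure μ]

theorem integrable_stepUpWeight {T : Ω → ℝ} (hT : Measurable T) {N : Ω → ℕ} (hN : Measurable N)
    (c : ℝ) : Integrable (fun ω => stepUpWeight c (T ω) (N ω)) μ := by
  refine Integrable.of_bound (Measurable.aestronglyMeasurable ?_) 1 (ae_of_all _ fun ω => ?_)
  · refine Measurable.ite (measurableSet_le hT ?_) ?_ measurable_const
    · exact (measurable_from_nat (f := fun k => c * (k : ℝ))).comp hN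
    · exact (measurable_from_nat (f := fun k => (k : ℝ)⁻¹)).comp hN
  · rw [Real.norm_of_nonneg (stepUpWeight_nonneg _ _ _), stepUpWeight]
    split_ifs
    · exact Nat.cast_inv_le_one _
    · exact zero_le_one

theorem measureReal_le_of_null {T : Ω → ℝ}
    (hnull : ∀ x : ℝ, 0 ≤ x → x ≤ 1 → μ {ω | T ω ≤ x} ≤ ENNReal.ofReal x) {x : ℝ} (hx : 0 ≤ x) :
    μ.real {ω | T ω ≤ x} ≤ x := by
  rcases le_total x 1 with h1 | h1
  · exact ENNReal.toReal_le_of_le_ofReal hx (hnull x hx h1)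
  · exact measureReal_le_one.trans h1

/-! ### Arbitrary dependence: summation by parts. -/

/-- A bound for `stepUpWeight` in which the (random) number `r` does not enter. -/
theorem stepUpWeight_le_sum {c t : ℝ} (hc : 0 ≤ c) {r K : ℕ} (hr : r ≤ K) :
    stepUpWeight c t r ≤
      ∑ k ∈ Finset.range K, ((k + 1 : ℝ) * (k + 2))⁻¹ * (if t ≤ c * (k + 1 : ℕ) then 1 else 0) +
        (K + 1 : ℝ)⁻¹ * (if t ≤ c * K then 1 else 0) := by
  by_cases ht : t ≤ c * r
  swap
  · rw [stepUpWeight, if_neg ht]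
    exact add_nonneg (Finset.sum_nonneg fun k _ => mul_nonneg (by positivity)
      (by split_ifs <;> simp)) (mul_nonneg (by positivity) (by split_ifs <;> simp))
  rw [stepUpWeight, if_pos ht]
  -- Indicators with index at least `r` equal one, and `1/(K+1) = 1/((K+1)(K+2)) + 1/(K+2)` makes
  -- the tail telescope to `1/r`. For `r = 0` the weight is `0⁻¹ = 0`.
  induction K, hr using Nat.le_induction with
  | base =>
    rw [if_pos ht]
    rcases r with _ | n
    · simp
    rw [Finset.sum_range_succ, if_pos ht]
    have h0 : 0 ≤ ∑ k ∈ Finset.range n,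
        ((k + 1 : ℝ) * (k + 2))⁻¹ * (if t ≤ c * (k + 1 : ℕ) then (1 : ℝ) else 0) :=
      Finset.sum_nonneg fun k _ => mul_nonneg (by positivity) (by split_ifs <;> simp)
    have h1 : ((n + 1 : ℕ) : ℝ)⁻¹ =
        ((n + 1 : ℝ) * (n + 2))⁻¹ * 1 + (((n + 1 : ℕ) : ℝ) + 1)⁻¹ * 1 := by
      push_cast
      field_simp
      ring
    linarith
  | succ K hK ih =>
    have hK' : (r : ℝ) ≤ K := by exact_mod_cast hK
    have h1 : t ≤ c * K := ht.trans (by gcongr)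
    have h2 : t ≤ c * (K + 1 : ℕ) := h1.trans (by push_cast; gcongr; linarith)
    rw [if_pos h1] at ih
    rw [Finset.sum_range_succ, if_pos h2]
    have h3 : (K + 1 : ℝ)⁻¹ * 1 =
        ((K + 1 : ℝ) * (K + 2))⁻¹ * 1 + (((K + 1 : ℕ) : ℝ) + 1)⁻¹ * 1 := by
      push_cast
      field_simp
      ring
    linarith

theorem sum_eq_mul_harmonic (c : ℝ) (K : ℕ) :
    ∑ k ∈ Finset.range K, ((k + 1 : ℝ) * (k + 2))⁻¹ * (c * (k + 1 : ℕ)) +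
      (K + 1 : ℝ)⁻¹ * (c * K) = c * (harmonic K : ℝ) := by
  induction K with
  | zero => simp
  | succ K ih =>
    have h1 : ((K + 1 : ℝ) * (K + 2))⁻¹ * (c * (K + 1 : ℕ)) +
        (((K + 1 : ℕ) : ℝ) + 1)⁻¹ * (c * (K + 1 : ℕ)) =
          (K + 1 : ℝ)⁻¹ * (c * K) + c * (K + 1 : ℝ)⁻¹ := by
      push_cast
      field_simp
      ring
    have h2 : ((harmonic (K + 1) : ℚ) : ℝ) = (harmonic K : ℝ) + (K + 1 : ℝ)⁻¹ := by
      rw [harmonic_succ]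
      push_cast
      rfl
    rw [h2, Finset.sum_range_succ, mul_add c, ← ih]
    linarith

theorem integral_stepUpWeight_le_harmonic {T : Ω → ℝ} (hT : Measurable T)
    (hnull : ∀ x : ℝ, 0 ≤ x → x ≤ 1 → μ {ω | T ω ≤ x} ≤ ENNReal.ofReal x)
    {N : Ω → ℕ} (hN : Measurable N) {K : ℕ} (hNK : ∀ ω, N ω ≤ K) {c : ℝ} (hc : 0 ≤ c) :
    ∫ ω, stepUpWeight c (T ω) (N ω) ∂μ ≤ c * (harmonic K : ℝ) := by
  have hms : ∀ x : ℝ, MeasurableSet {ω | T ω ≤ x} := fun x => measurableSet_le hT measurable_const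
  have hind : ∀ x : ℝ, (fun ω => if T ω ≤ x then (1 : ℝ) else 0) =
      {ω | T ω ≤ x}.indicator fun _ => 1 := fun x => rfl
  have hint : ∀ x : ℝ, Integrable (fun ω => if T ω ≤ x then (1 : ℝ) else 0) μ := fun x => by
    rw [hind]
    exact (integrable_const _).indicator (hms x)
  have hE : ∀ x : ℝ, 0 ≤ x → ∫ ω, (if T ω ≤ x then (1 : ℝ) else 0) ∂μ ≤ x := fun x hx => by
    rw [hind, integral_indicator_const _ (hms x), smul_eq_mul, mul_one]
    exact measureReal_le_of_null hnull hx
  refine (integral_mono (integrable_stepUpWeight hT hN c) ?_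
    fun ω => stepUpWeight_le_sum hc (hNK ω)).trans ?_
  · exact (integrable_finsetSum _ fun k _ => (hint _).const_mul _).add ((hint _).const_mul _)
  rw [integral_add (integrable_finsetSum _ fun k _ => (hint _).const_mul _)
    ((hint _).const_mul _), integral_finsetSum _ fun k _ => (hint _).const_mul _,
    ← sum_eq_mul_harmonic]
  simp only [integral_const_mul]
  gcongr
  · exact hE _ (by positivity)
  · exact hE _ (by positivity)

/-! ### Positive regression dependency. -/

/-- Under positive regression dependency, the conditional probability of an increasing event given
`X i ≤ s` is nondecreasing in `s`. -/
theorem IsPRDS.measureReal_mul_le {m : ℕ} {X : Fin m → Ω → ℝ} (hX : ∀ j, Measurable (X j))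
    {n : Fin m → Prop} (h : IsPRDS μ X n) {i : Fin m} (hi : n i) {D : Set (Fin m → ℝ)}
    (hD : MeasurableSet D) (hDu : IsUpperSet D) {s t : ℝ} (hst : s ≤ t) :
    μ.real ({ω | X i ω ≤ s} ∩ {ω | (fun j => X j ω) ∈ D}) * μ.real {ω | X i ω ≤ t} ≤
      μ.real ({ω | X i ω ≤ t} ∩ {ω | (fun j => X j ω) ∈ D}) * μ.real {ω | X i ω ≤ s} := by
  obtain ⟨g, hg, hgE⟩ := h D hD hDu i hi
  set E : Set Ω := (fun ω j => X j ω) ⁻¹' D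
  have hE : MeasurableSet E := (measurable_pi_lambda _ hX) hD
  have hgint : Integrable (fun ω => g (X i ω)) μ := integrable_condExp.congr hgE
  have hset : ∀ B : Set ℝ, MeasurableSet B →
      ∫ ω in X i ⁻¹' B, g (X i ω) ∂μ = μ.real (X i ⁻¹' B ∩ E) := fun B hB => by
    rw [← setIntegral_congr_ae (hX i hB) (hgE.mono fun ω hω _ => hω),
      setIntegral_condExp (hX i).comap_le ((integrable_const _).indicator hE) ⟨B, hB, rfl⟩,
      setIntegral_indicator hE]
    simp
  -- The value `g s` separates the mean of `g` over `X i ≤ s` from its mean over `s < X i ≤ t`, so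
  -- adding the second slab cannot lower the average.
  have h1 : μ.real (X i ⁻¹' Set.Iic s ∩ E) ≤ g s * μ.real (X i ⁻¹' Set.Iic s) := by
    rw [← hset _ measurableSet_Iic, mul_comm, ← smul_eq_mul, ← setIntegral_const]
    exact setIntegral_mono_on hgint.integrableOn integrableOn_const (hX i measurableSet_Iic)
      fun ω hω => hg hω
  have h2 : g s * μ.real (X i ⁻¹' Set.Ioc s t) ≤ μ.real (X i ⁻¹' Set.Ioc s t ∩ E) := by
    rw [← hset _ measurableSet_Ioc, mul_comm, ← smul_eq_mul, ← setIntegral_const]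
    exact setIntegral_mono_on integrableOn_const hgint.integrableOn (hX i measurableSet_Ioc)
      fun ω hω => hg hω.1.le
  have hdisj : Disjoint (X i ⁻¹' Set.Iic s) (X i ⁻¹' Set.Ioc s t) :=
    Disjoint.preimage _ (Set.Iic_disjoint_Ioc le_rfl)
  have h3 : μ.real (X i ⁻¹' Set.Iic t) =
      μ.real (X i ⁻¹' Set.Iic s) + μ.real (X i ⁻¹' Set.Ioc s t) := by
    rw [← Set.Iic_union_Ioc_eq_Iic hst, Set.preimage_union,
      measureReal_union hdisj (hX i measurableSet_Ioc)]
  have h4 : μ.real (X i ⁻¹' Set.Iic t ∩ E) =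
      μ.real (X i ⁻¹' Set.Iic s ∩ E) + μ.real (X i ⁻¹' Set.Ioc s t ∩ E) := by
    rw [← Set.Iic_union_Ioc_eq_Iic hst, Set.preimage_union, Set.union_inter_distrib_right,
      measureReal_union (hdisj.mono Set.inter_subset_left Set.inter_subset_left)
        ((hX i measurableSet_Ioc).inter hE)]
  change μ.real (X i ⁻¹' Set.Iic s ∩ E) * μ.real (X i ⁻¹' Set.Iic t) ≤
    μ.real (X i ⁻¹' Set.Iic t ∩ E) * μ.real (X i ⁻¹' Set.Iic s)
  rw [h3, h4]
  have h5 := mul_le_mul_of_nonneg_right h1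
    (measureReal_nonneg (μ := μ) (s := X i ⁻¹' Set.Ioc s t))
  have h6 := mul_le_mul_of_nonneg_right h2
    (measureReal_nonneg (μ := μ) (s := X i ⁻¹' Set.Iic s))
  linarith

/-- With `A k = {X i ≤ c k}`, each term `Pr(A k, F = k)/k` is at most `c Pr(F = k | A k)`. PRDS
gives `Pr(F ≤ k | A k) ≤ Pr(F ≤ k | A (k+1))`, so the terms telescope to at most `c Pr(F ≤ K | A K)
≤ c`. -/
theorem IsPRDS.integral_stepUpWeight_le {m : ℕ} {X : Fin m → Ω → ℝ} (hX : ∀ j, Measurable (X j))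
    {n : Fin m → Prop} (h : IsPRDS μ X n) {i : Fin m} (hi : n i)
    (hnull : ∀ x : ℝ, 0 ≤ x → x ≤ 1 → μ {ω | X i ω ≤ x} ≤ ENNReal.ofReal x)
    {f : (Fin m → ℝ) → ℕ} (hf : Measurable f) (hfa : Antitone f) {K : ℕ} (hfK : ∀ x, f x ≤ K)
    {c : ℝ} (hc : 0 ≤ c) :
    ∫ ω, stepUpWeight c (X i ω) (f fun j => X j ω) ∂μ ≤ c := by
  have hXm : Measurable fun ω j => X j ω := measurable_pi_lambda _ hX
  set F : Ω → ℕ := fun ω => f fun j => X j ω with hFdef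
  have hF : Measurable F := hf.comp hXm
  set A : ℕ → Set Ω := fun k => {ω | X i ω ≤ c * k} with hAdef
  have hA : ∀ k, MeasurableSet (A k) := fun k => measurableSet_le (hX i) measurable_const
  have hAmono : Monotone A := fun k l hkl ω hω => by
    have : (k : ℝ) ≤ l := by exact_mod_cast hkl
    exact (show X i ω ≤ c * k from hω).trans (mul_le_mul_of_nonneg_left this hc)
  have hAle : ∀ k : ℕ, μ.real (A k) ≤ c * k := fun k => measureReal_le_of_null hnull (by positivity)
  have hEq : ∀ k, MeasurableSet {ω | F ω = k} := fun k => hF (measurableSet_singleton k)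
  set s : ℕ → ℝ := fun k => ∑ l ∈ Finset.range k,
    ((l + 1 : ℕ) : ℝ)⁻¹ * μ.real (A (l + 1) ∩ {ω | F ω = l + 1}) with hsdef
  have hs0 : ∀ k, μ.real (A k) = 0 → s k = 0 := fun k hk => by
    refine Finset.sum_eq_zero fun l hl => ?_
    rw [measureReal_mono_null (s₂ := A k) ?_ hk, mul_zero]
    exact Set.inter_subset_left.trans (hAmono (Finset.mem_range.1 hl))
  have hint : ∫ ω, stepUpWeight c (X i ω) (F ω) ∂μ = s K := by
    have hpt : ∀ ω, stepUpWeight c (X i ω) (F ω) = ∑ l ∈ Finset.range K,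
        (A (l + 1) ∩ {ω | F ω = l + 1}).indicator (fun _ => ((l + 1 : ℕ) : ℝ)⁻¹) ω := fun ω => by
      rcases hk : F ω with _ | k
      · simp [stepUpWeight, Set.indicator, hk]
      · have hkK : k < K := by
          have := hfK fun j => X j ω
          change F ω ≤ K at this
          omega
        rw [Finset.sum_eq_single_of_mem k (Finset.mem_range.2 hkK)]
        · simp [stepUpWeight, Set.indicator, hk, hAdef]
        · intro l _ hl
          refine Set.indicator_of_notMem (fun h' => hl ?_) _
          have := h'.2
          simp only [Set.mem_ofPred_eq, hk] at this
          omega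
    simp only [hpt]
    rw [integral_finsetSum _ fun l _ => (integrable_const _).indicator ((hA _).inter (hEq _))]
    refine Finset.sum_congr rfl fun l _ => ?_
    rw [integral_indicator_const _ ((hA _).inter (hEq _)), smul_eq_mul, mul_comm]
  -- This is `s k ≤ c Pr(F ≤ k | A k)`, multiplied out because `A k` may be null, in which case `s k
  -- = 0`.
  have key : ∀ k, s k * μ.real (A k) ≤ c * μ.real (A k ∩ {ω | F ω ≤ k}) := by
    intro k
    induction k with
    | zero => simp only [hsdef, Finset.range_zero, Finset.sum_empty, zero_mul]; positivity
    | succ k ih =>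
      have hD : MeasurableSet {x | f x ≤ k} := hf (measurableSet_Iic (a := k))
      have hDu : IsUpperSet {x | f x ≤ k} := fun x y hxy hx => (hfa hxy).trans hx
      have hkk : c * (k : ℝ) ≤ c * ((k + 1 : ℕ) : ℝ) := by push_cast; gcongr; linarith
      have hmono := h.measureReal_mul_le hX hi hD hDu hkk
      change μ.real (A k ∩ {ω | F ω ≤ k}) * μ.real (A (k + 1)) ≤
        μ.real (A (k + 1) ∩ {ω | F ω ≤ k}) * μ.real (A k) at hmono
      have h1 : s k * μ.real (A (k + 1)) ≤ c * μ.real (A (k + 1) ∩ {ω | F ω ≤ k}) := by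
        rcases eq_or_lt_of_le (measureReal_nonneg (μ := μ) (s := A k)) with h0 | h0
        · rw [hs0 k h0.symm, zero_mul]
          positivity
        · refine le_of_mul_le_mul_right ?_ h0
          calc s k * μ.real (A (k + 1)) * μ.real (A k)
              = s k * μ.real (A k) * μ.real (A (k + 1)) := by ring
            _ ≤ c * μ.real (A k ∩ {ω | F ω ≤ k}) * μ.real (A (k + 1)) := by gcongr
            _ = c * (μ.real (A k ∩ {ω | F ω ≤ k}) * μ.real (A (k + 1))) := by ring
            _ ≤ c * (μ.real (A (k + 1) ∩ {ω | F ω ≤ k}) * μ.real (A k)) := by gcongr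
            _ = c * μ.real (A (k + 1) ∩ {ω | F ω ≤ k}) * μ.real (A k) := by ring
      have h2 : ((k + 1 : ℕ) : ℝ)⁻¹ * μ.real (A (k + 1) ∩ {ω | F ω = k + 1}) * μ.real (A (k + 1)) ≤
          c * μ.real (A (k + 1) ∩ {ω | F ω = k + 1}) := by
        have h3 : ((k + 1 : ℕ) : ℝ)⁻¹ * μ.real (A (k + 1)) ≤ c := by
          rw [inv_mul_le_iff₀ (by positivity), mul_comm]
          exact hAle (k + 1)
        calc _ = ((k + 1 : ℕ) : ℝ)⁻¹ * μ.real (A (k + 1)) *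
              μ.real (A (k + 1) ∩ {ω | F ω = k + 1}) := by ring
          _ ≤ _ := by gcongr
      have h4 : μ.real (A (k + 1) ∩ {ω | F ω ≤ k + 1}) =
          μ.real (A (k + 1) ∩ {ω | F ω ≤ k}) + μ.real (A (k + 1) ∩ {ω | F ω = k + 1}) := by
        rw [← measureReal_union _ ((hA _).inter (hEq _)), ← Set.inter_union_distrib_left]
        · congr 2
          ext ω
          simp only [Set.mem_ofPred_eq, Set.mem_union]
          omega
        · refine Set.disjoint_left.2 fun ω h5 h6 => ?_
          have h7 := h5.2
          have h8 := h6.2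
          simp only [Set.mem_ofPred_eq] at h7 h8
          omega
      have h5 : s (k + 1) =
          s k + ((k + 1 : ℕ) : ℝ)⁻¹ * μ.real (A (k + 1) ∩ {ω | F ω = k + 1}) :=
        Finset.sum_range_succ _ _
      rw [h4, h5]
      linarith
  rw [hint]
  rcases eq_or_lt_of_le (measureReal_nonneg (μ := μ) (s := A K)) with h0 | h0
  · rwa [hs0 K h0.symm]
  · refine le_of_mul_le_mul_right ((key K).trans ?_) h0
    exact mul_le_mul_of_nonneg_left (measureReal_mono Set.inter_subset_left) hc

/-! ### Conditioning on the primary study. -/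

/-- A bound for the conditional expectations given the first of two independent variables bounds
the expectation. -/
theorem integral_le_of_indepFun {α β : Type*} [MeasurableSpace α] [MeasurableSpace β]
    {X : Ω → α} {Y : Ω → β} (hX : Measurable X) (hY : Measurable Y) (hXY : IndepFun X Y μ)
    {F : α × β → ℝ} (hF : Measurable F) (hFi : Integrable F (μ.map fun ω => (X ω, Y ω))) {b : ℝ}
    (hb : ∀ x, ∫ ω, F (x, Y ω) ∂μ ≤ b) : ∫ ω, F (X ω, Y ω) ∂μ ≤ b := by
  have hpX : IsProbabilityMeasure (μ.map X) := Measure.isProbabilityMeasure_map hX.aemeasurable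
  have hpY : IsProbabilityMeasure (μ.map Y) := Measure.isProbabilityMeasure_map hY.aemeasurable
  rw [← integral_map (φ := fun ω => (X ω, Y ω)) (hX.prodMk hY).aemeasurable
    hF.aestronglyMeasurable]
  rw [(indepFun_iff_map_prod_eq_prod_map_map hX.aemeasurable hY.aemeasurable).1 hXY] at hFi ⊢
  rw [integral_prod _ hFi]
  calc ∫ x, ∫ y, F (x, y) ∂μ.map Y ∂μ.map X ≤ ∫ _, b ∂μ.map X := by
        refine integral_mono hFi.integral_prod_left (integrable_const b) fun x => ?_
        exact (integral_map (f := fun y => F (x, y)) hY.aemeasurable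
          (hF.comp measurable_prodMk_left).aestronglyMeasurable).trans_le (hb x)
    _ = b := by simp

/-- The false discovery rate of a procedure is at most `a + b` if the primary-study nulls
contribute at most `a / m` each and, for each value of the primary-study `p`-values, the follow-up
nulls contribute at most `b` in total. -/
theorem integral_falseDiscoveryProportion_le {m : ℕ} (h : Fin 2 → Fin m → Bool) {i i' : Fin 2}
    (hi : i ≠ i') {P : Fin 2 → Fin m → Ω → ℝ} (hP : ∀ i j, Measurable (P i j))
    (hindep : IndepFun (fun ω j => P i j ω) (fun ω j => P i' j ω) μ)
    {A : (Fin m → ℝ) → (Fin m → ℝ) → Finset (Fin m)}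
    (hA : ∀ j, MeasurableSet {p : (Fin m → ℝ) × (Fin m → ℝ) | j ∈ A p.1 p.2}) {a b : ℝ}
    (ha : 0 ≤ a)
    (hprimary : ∀ j, h i j = false →
      ∫ ω, rejectionWeight j (A (fun j => P i j ω) fun j => P i' j ω) ∂μ ≤ a / m)
    (hfollow : ∀ x, ∑ j with h i' j = false,
      ∫ ω, rejectionWeight j (A x fun j => P i' j ω) ∂μ ≤ b) :
    ∫ ω, falseDiscoveryProportion h (A (fun j => P i j ω) fun j => P i' j ω) ∂μ ≤ a + b := by
  have hm : ∀ i, Measurable fun ω j => P i j ω := fun i => measurable_pi_lambda _ (hP i)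
  have hAω : ∀ j, MeasurableSet {ω | j ∈ A (fun j => P i j ω) fun j => P i' j ω} := fun j =>
    ((hm i).prodMk (hm i')) (hA j)
  have hAx : ∀ x j, MeasurableSet {ω | j ∈ A x fun j => P i' j ω} := fun x j =>
    (measurable_const.prodMk (hm i')) (hA j)
  have hprob : IsProbabilityMeasure (μ.map fun ω => (fun j => P i j ω, fun j => P i' j ω)) :=
    Measure.isProbabilityMeasure_map ((hm i).prodMk (hm i')).aemeasurable
  refine (integral_mono (integrable_comp_finset hAω _) ((integrable_comp_finset hAω
    (fun T => ∑ j with h i j = false, rejectionWeight j T)).add (integrable_comp_finset hAω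
    (fun T => ∑ j with h i' j = false, rejectionWeight j T)))
    fun ω => falseDiscoveryProportion_le_sum h hi _).trans ?_
  rw [integral_add' (integrable_comp_finset hAω
    (fun T => ∑ j with h i j = false, rejectionWeight j T)) (integrable_comp_finset hAω
    (fun T => ∑ j with h i' j = false, rejectionWeight j T))]
  refine add_le_add ?_ ?_
  · rw [integral_finsetSum _ fun j _ => integrable_comp_finset hAω _]
    refine (Finset.sum_le_sum fun j hj => hprimary j (Finset.mem_filter.1 hj).2).trans ?_
    rw [Finset.sum_const, nsmul_eq_mul]
    have hcard : ((Finset.univ.filter fun j => h i j = false).card : ℝ) ≤ m := by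
      exact_mod_cast (Finset.card_le_univ _).trans_eq (Fintype.card_fin m)
    calc _ ≤ m * (a / m) := by gcongr
      _ ≤ a := natCast_mul_div_le ha m
  · refine integral_le_of_indepFun (hm i) (hm i') hindep
      (F := fun p => ∑ j with h i' j = false, rejectionWeight j (A p.1 p.2))
      (measurable_comp_finset hA fun T => ∑ j with h i' j = false, rejectionWeight j T)
      (integrable_comp_finset hA fun T => ∑ j with h i' j = false, rejectionWeight j T) fun x => ?_
    rw [integral_finsetSum _ fun j _ => integrable_comp_finset (hAx x) _]
    exact hfollow x

/-- At most `|S|` indices contribute, each at most `b/|S|`; an empty `S` contributes nothing. -/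
theorem sum_filter_le_of_selected {m : ℕ} {n : Fin m → Prop} [DecidablePred n]
    {S : Finset (Fin m)} {u : Fin m → ℝ} {b : ℝ} (hb : 0 ≤ b) (h0 : ∀ j ∉ S, u j = 0)
    (hu : ∀ j ∈ S, n j → u j ≤ b / S.card) : ∑ j with n j, u j ≤ b := by
  calc ∑ j with n j, u j ≤ ∑ j with n j, if j ∈ S then b / S.card else 0 := by
        refine Finset.sum_le_sum fun j hj => ?_
        split_ifs with hjS
        · exact hu j hjS (Finset.mem_filter.1 hj).2
        · exact (h0 j hjS).le
    _ ≤ ∑ j, if j ∈ S then b / S.card else 0 :=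
        Finset.sum_le_sum_of_subset_of_nonneg (Finset.filter_subset _ _)
          fun j _ _ => by split_ifs <;> positivity
    _ = S.card * (b / S.card) := by
        rw [← Finset.sum_filter, Finset.sum_const, nsmul_eq_mul, Finset.filter_univ_mem]
    _ ≤ b := natCast_mul_div_le hb _

theorem bonferroniSelection_isMeasurable (m : ℕ) (α : ℝ) :
    (bonferroniSelection m α).IsMeasurable := fun j => by
  simp only [bonferroniSelection, Finset.mem_filter, Finset.mem_univ, true_and]
  exact measurableSet_le (measurable_pi_apply j) measurable_const

theorem measurableSet_mem_twoStageFDR {m : ℕ} (a q : ℝ) {sel : SelectionRule m}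
    (hsel : sel.IsMeasurable) (j : Fin m) :
    MeasurableSet {p : (Fin m → ℝ) × (Fin m → ℝ) | j ∈ twoStageFDR a q sel p.1 p.2} :=
  measurableSet_mem_twoStageRejections_sel (fun _ => a) (fun _ => q - a) hsel j

theorem measurableSet_mem_twoStageFDRHarmonic {m : ℕ} (a q : ℝ) {sel : SelectionRule m}
    (hsel : sel.IsMeasurable) (j : Fin m) :
    MeasurableSet {p : (Fin m → ℝ) × (Fin m → ℝ) | j ∈ twoStageFDRHarmonic a q sel p.1 p.2} :=
  measurableSet_mem_twoStageRejections_sel (fun _ => a / (harmonic m : ℝ))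
    (fun S => (q - a) / (harmonic S.card : ℝ)) hsel j

theorem measurable_twoStageCount_right {m : ℕ} (a b : ℝ) (S : Finset (Fin m)) (x : Fin m → ℝ) :
    Measurable fun y => twoStageCount a b S x y :=
  (measurable_twoStageCount a b S).comp (measurable_const.prodMk measurable_id)

/-! ### FDR of a single run of the two stage procedure. -/

section Procedures

variable {m : ℕ} {h : Fin 2 → Fin m → Bool} {i i' : Fin 2} {P : Fin 2 → Fin m → Ω → ℝ} {a q : ℝ}

theorem integral_falseDiscoveryProportion_twoStageFDR_le (hi : i ≠ i')
    (hP : ∀ i j, Measurable (P i j))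
    (hnull : ∀ i j, h i j = false →
      ∀ x : ℝ, 0 ≤ x → x ≤ 1 → μ {ω | P i j ω ≤ x} ≤ ENNReal.ofReal x)
    (hindep : IndepFun (fun ω j => P i j ω) (fun ω j => P i' j ω) μ)
    (hprds : IsPRDS μ (P i') fun j => h i' j = false) (ha : 0 ≤ a) (haq : a ≤ q) :
    ∫ ω, falseDiscoveryProportion h (twoStageFDR a q (bonferroniSelection m a)
      (fun j => P i j ω) fun j => P i' j ω) ∂μ ≤ q := by
  have hb : 0 ≤ q - a := sub_nonneg.2 haq
  have hm : ∀ i, Measurable fun ω j => P i j ω := fun i => measurable_pi_lambda _ (hP i)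
  have hA := measurableSet_mem_twoStageFDR a q (bonferroniSelection_isMeasurable m a)
  refine (integral_falseDiscoveryProportion_le h hi hP hindep hA ha (b := q - a)
    (fun j hj => ?_) fun x => ?_).trans_eq (add_sub_cancel a q)
  · have hAω : ∀ j, MeasurableSet {ω | j ∈ twoStageFDR a q (bonferroniSelection m a)
      (fun j => P i j ω) fun j => P i' j ω} := fun j => ((hm i).prodMk (hm i')) (hA j)
    have hms : MeasurableSet {ω | P i j ω ≤ a / m} := measurableSet_le (hP i j) measurable_const
    -- A rejected index was selected, so the weight, at most one, vanishes off the Bonferroni event.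
    have hle : ∀ ω, rejectionWeight j (twoStageFDR a q (bonferroniSelection m a)
        (fun j => P i j ω) fun j => P i' j ω) ≤ {ω | P i j ω ≤ a / m}.indicator 1 ω := fun ω => by
      by_cases hω : P i j ω ≤ a / m
      · rw [Set.indicator_of_mem (by exact hω)]
        exact rejectionWeight_le_one _ _
      · rw [Set.indicator_of_notMem (by exact hω)]
        refine (rejectionWeight_eq_zero fun hj => hω ?_).le
        simpa [bonferroniSelection] using hj
    refine (integral_mono (integrable_comp_finset hAω _)
      ((integrable_const (1 : ℝ)).indicator hms) hle).trans ?_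
    refine (integral_indicator_one hms).trans_le ?_
    exact measureReal_le_of_null (hnull i j hj) (by positivity)
  · refine sum_filter_le_of_selected (S := bonferroniSelection m a x) hb
      (fun j hj => integral_eq_zero_of_ae (ae_of_all _ fun ω => rejectionWeight_eq_zero hj))
      fun j _ hj => ?_
    have hAx : ∀ j, MeasurableSet {ω | j ∈ twoStageFDR a q (bonferroniSelection m a) x
      fun j => P i' j ω} := fun j => (measurable_const.prodMk (hm i')) (hA j)
    have hf := measurable_twoStageCount_right a (q - a) (bonferroniSelection m a x) x
    refine (integral_mono (integrable_comp_finset hAx _)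
      (integrable_stepUpWeight (hP i' j) (hf.comp (hm i')) _)
      fun ω => rejectionWeight_le_stepUpWeight_followUp ha hb j).trans ?_
    exact hprds.integral_stepUpWeight_le (hP i') hj (hnull i' j hj) hf
      (antitone_twoStageCount ha hb) (fun _ => twoStageCount_le) (by positivity)

theorem integral_falseDiscoveryProportion_twoStageFDRHarmonic_le (hi : i ≠ i')
    (hP : ∀ i j, Measurable (P i j))
    (hnull : ∀ i j, h i j = false →
      ∀ x : ℝ, 0 ≤ x → x ≤ 1 → μ {ω | P i j ω ≤ x} ≤ ENNReal.ofReal x)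
    (hindep : IndepFun (fun ω j => P i j ω) (fun ω j => P i' j ω) μ)
    {sel : SelectionRule m} (hsel : sel.IsMeasurable) (ha : 0 ≤ a) (haq : a ≤ q) :
    ∫ ω, falseDiscoveryProportion h (twoStageFDRHarmonic a q sel
      (fun j => P i j ω) fun j => P i' j ω) ∂μ ≤ q := by
  have hb : 0 ≤ q - a := sub_nonneg.2 haq
  have hm : ∀ i, Measurable fun ω j => P i j ω := fun i => measurable_pi_lambda _ (hP i)
  have hA := measurableSet_mem_twoStageFDRHarmonic a q hsel
  have hH0 : ∀ n : ℕ, (0 : ℝ) ≤ (harmonic n : ℝ) := fun n => by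
    exact_mod_cast Finset.sum_nonneg fun k _ => by positivity
  have hH : ∀ n : ℕ, n ≠ 0 → (harmonic n : ℝ) ≠ 0 := fun n hn => by
    exact_mod_cast (harmonic_pos hn).ne'
  have ha' : 0 ≤ a / (harmonic m : ℝ) := div_nonneg ha (hH0 m)
  have hb' : ∀ n : ℕ, 0 ≤ (q - a) / (harmonic n : ℝ) := fun n => div_nonneg hb (hH0 n)
  refine (integral_falseDiscoveryProportion_le h hi hP hindep hA ha (b := q - a)
    (fun j hj => ?_) fun x => ?_).trans_eq (add_sub_cancel a q)
  · set N : Ω → ℕ := fun ω => (twoStageFDRHarmonic a q sel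
      (fun j => P i j ω) fun j => P i' j ω).card with hNdef
    have hAω : ∀ j, MeasurableSet {ω | j ∈ twoStageFDRHarmonic a q sel
      (fun j => P i j ω) fun j => P i' j ω} := fun j => ((hm i).prodMk (hm i')) (hA j)
    have hN : Measurable N := measurable_comp_finset hAω Finset.card
    -- The index `j` itself rules out `m = 0`, so the harmonic number cancels.
    have hm0 : m ≠ 0 := (Fin.pos j).ne'
    refine (integral_mono (integrable_comp_finset hAω _)
      (integrable_stepUpWeight (hP i j) hN (a / (harmonic m : ℝ) / m)) fun ω => ?_).trans
      ((integral_stepUpWeight_le_harmonic (hP i j) (hnull i j hj) hN (K := m)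
        (fun ω => (Finset.card_le_univ _).trans_eq (Fintype.card_fin m))
        (by positivity)).trans_eq ?_)
    · simp only [hNdef, twoStageFDRHarmonic]
      rw [card_twoStageRejections ha' (hb' _)]
      exact rejectionWeight_le_stepUpWeight_primary (p₁ := fun j => P i j ω) ha' (hb' _) j
    · have := hH m hm0
      field_simp
  · refine sum_filter_le_of_selected (S := sel x) hb
      (fun j hj => integral_eq_zero_of_ae (ae_of_all _ fun ω => rejectionWeight_eq_zero hj))
      fun j hjS hj => ?_
    have hAx : ∀ j, MeasurableSet {ω | j ∈ twoStageFDRHarmonic a q sel x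
      fun j => P i' j ω} := fun j => (measurable_const.prodMk (hm i')) (hA j)
    have hf := measurable_twoStageCount_right (a / (harmonic m : ℝ))
      ((q - a) / (harmonic (sel x).card : ℝ)) (sel x) x
    have hS0 : (sel x).card ≠ 0 := (Finset.card_pos.2 ⟨j, hjS⟩).ne'
    refine (integral_mono (integrable_comp_finset hAx _)
      (integrable_stepUpWeight (hP i' j) (hf.comp (hm i')) _)
      fun ω => rejectionWeight_le_stepUpWeight_followUp ha' (hb' _) j).trans
      ((integral_stepUpWeight_le_harmonic (hP i' j) (hnull i' j hj) (hf.comp (hm i'))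
        (fun _ => twoStageCount_le) (div_nonneg (hb' _) (Nat.cast_nonneg _))).trans_eq ?_)
    have := hH _ hS0
    field_simp

end Procedures

theorem controlsFDR_union {m : ℕ} {h : Fin 2 → Fin m → Bool} {P : Fin 2 → Fin m → Ω → ℝ}
    (hP : ∀ i j, Measurable (P i j)) {A B : (Fin m → ℝ) → (Fin m → ℝ) → Finset (Fin m)}
    (hA : ∀ j, MeasurableSet {p : (Fin m → ℝ) × (Fin m → ℝ) | j ∈ A p.1 p.2})
    (hB : ∀ j, MeasurableSet {p : (Fin m → ℝ) × (Fin m → ℝ) | j ∈ B p.1 p.2}) {α β : ℝ}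
    (hAle : ∫ ω, falseDiscoveryProportion h (A (fun j => P 0 j ω) fun j => P 1 j ω) ∂μ ≤ α)
    (hBle : ∫ ω, falseDiscoveryProportion h (B (fun j => P 1 j ω) fun j => P 0 j ω) ∂μ ≤ β) :
    ControlsFDR μ h P (fun p₁ p₂ => A p₁ p₂ ∪ B p₂ p₁) (α + β) := by
  have hm : ∀ i, Measurable fun ω j => P i j ω := fun i => measurable_pi_lambda _ (hP i)
  have hAω : ∀ j, MeasurableSet {ω | j ∈ A (fun j => P 0 j ω) fun j => P 1 j ω} := fun j =>
    ((hm 0).prodMk (hm 1)) (hA j)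
  have hBω : ∀ j, MeasurableSet {ω | j ∈ B (fun j => P 1 j ω) fun j => P 0 j ω} := fun j =>
    ((hm 1).prodMk (hm 0)) (hB j)
  have hU : ∀ j, MeasurableSet {ω | j ∈ (A (fun j => P 0 j ω) fun j => P 1 j ω) ∪
      B (fun j => P 1 j ω) fun j => P 0 j ω} := fun j => by
    simp only [Finset.mem_union]
    exact (hAω j).union (hBω j)
  refine ⟨integrable_comp_finset hU _, ?_⟩
  refine (integral_mono (integrable_comp_finset hU _) ((integrable_comp_finset hAω
    (falseDiscoveryProportion h)).add (integrable_comp_finset hBω (falseDiscoveryProportion h)))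
    fun ω => falseDiscoveryProportion_union_le h _ _).trans ?_
  rw [integral_add' (integrable_comp_finset hAω (falseDiscoveryProportion h))
    (integrable_comp_finset hBω (falseDiscoveryProportion h))]
  exact add_le_add hAle hBle

end Expectation

theorem theoremS3p3 {Ω : Type*} [MeasurableSpace Ω] (μ : Measure Ω) [IsProbabilityMeasure μ]
    (m : ℕ) (h : Fin 2 → Fin m → Bool) (P : Fin 2 → Fin m → Ω → ℝ)
    (hP : ∀ i j, Measurable (P i j))
    (hnull : ∀ i j, h i j = false →
      ∀ x : ℝ, 0 ≤ x → x ≤ 1 → μ {ω | P i j ω ≤ x} ≤ ENNReal.ofReal x)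
    (hindep : IndepFun (fun ω j => P 0 j ω) (fun ω j => P 1 j ω) μ)
    (w₁ q₁ q : ℝ) (hw₀ : 0 ≤ w₁) (hw₁ : w₁ ≤ 1) (hq₁ : 0 < q₁) (hq₁q : q₁ < q) (hq : q < 1) :
    ((∀ i, IsPRDS μ (P i) fun j => h i j = false) →
      ControlsFDR μ h P
        (generalizedTwoStage twoStageFDR w₁ q₁ q (bonferroniSelection m (w₁ * q₁))
          (bonferroniSelection m ((1 - w₁) * q₁))) q) ∧
    (∀ sel₁ sel₂ : SelectionRule m, sel₁.IsMeasurable → sel₂.IsMeasurable →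
      ControlsFDR μ h P (generalizedTwoStage twoStageFDRHarmonic w₁ q₁ q sel₁ sel₂) q) := by
  have h0 : 0 ≤ w₁ * q₁ := mul_nonneg hw₀ hq₁.le
  have h0' : 0 ≤ (1 - w₁) * q₁ := mul_nonneg (sub_nonneg.2 hw₁) hq₁.le
  have h1 : w₁ * q₁ ≤ w₁ * q := mul_le_mul_of_nonneg_left hq₁q.le hw₀
  have h1' : (1 - w₁) * q₁ ≤ (1 - w₁) * q := mul_le_mul_of_nonneg_left hq₁q.le (sub_nonneg.2 hw₁)
  have hsum : q = w₁ * q + (1 - w₁) * q := by ring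
  refine ⟨fun hprds => ?_, fun sel₁ sel₂ hsel₁ hsel₂ => ?_⟩
  · have key := controlsFDR_union hP
      (measurableSet_mem_twoStageFDR (w₁ * q₁) (w₁ * q) (bonferroniSelection_isMeasurable m _))
      (measurableSet_mem_twoStageFDR ((1 - w₁) * q₁) ((1 - w₁) * q)
        (bonferroniSelection_isMeasurable m _))
      (integral_falseDiscoveryProportion_twoStageFDR_le (by decide) hP hnull hindep
        (hprds 1) h0 h1)
      (integral_falseDiscoveryProportion_twoStageFDR_le (by decide) hP hnull hindep.symm
        (hprds 0) h0' h1')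
    rwa [← hsum] at key
  · have key := controlsFDR_union hP
      (measurableSet_mem_twoStageFDRHarmonic (w₁ * q₁) (w₁ * q) hsel₁)
      (measurableSet_mem_twoStageFDRHarmonic ((1 - w₁) * q₁) ((1 - w₁) * q) hsel₂)
      (integral_falseDiscoveryProportion_twoStageFDRHarmonic_le (by decide) hP hnull hindep
        hsel₁ h0 h1)
      (integral_falseDiscoveryProportion_twoStageFDRHarmonic_le (by decide) hP hnull hindep.symm
        hsel₂ h0' h1')
    rwa [← hsum] at key
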